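/- All digraphs are finite and simple (no loops, no multiple arcs). A digraph is strongly connected if for every ordered pair of vertices $(u,v)$ there is a directed path from $u$ to $v$. The arc connectivity of a strongly connected digraph is the minimum number of arcs whose deletion yields a digraph that is not strongly connected. For $n,k$ with $1\le k\le n-2$ let $\mathcal{L}_{n,k}$ be the set of strongly connected digraphs with $n$ vertices and arc connectivity $k$. For $0\le\alpha\le 1$ let $A_\alpha(G)=\alpha D(G)+(1-\alpha)A(G)$, where $A(G)$ is the adjacency matrix of $G$ (entry $1$ at $(u,v)$ if there is an arc from $u$ to $v$, and $0$ otherwise) and $D(G)$ is the diagonal matrix of outdegrees, and let $\lambda_\alpha(G)$ be the spectral radius of $A_\alpha(G)$, that is, the largest modulus of its eigenvalues. For $1\le m\le n-k-1$ let $K(n,k,m)$ be the digraph obtained from three disjoint complete digraphs $\overset{\longleftrightarrow}{K}_k$, $\overset{\longleftrightarrow}{K}_{n-k-m}$ and $\overset{\longleftrightarrow}{K}_m$ by adding all arcs in both directions between $\overset{\longleftrightarrow}{K}_k$ and the other two, and all arcs from $\overset{\longleftrightarrow}{K}_m$ to $\overset{\longleftrightarrow}{K}_{n-k-m}$. Theorem.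 Let $n,k$ be integers with $1\le k\le n-2$. Then $K(n,k,n-k-1)$ and $K(n,k,1)$ belong to $\mathcal{L}_{n,k}$, and for every $G\in\mathcal{L}_{n,k}$: (i) For $\alpha=0$, $\lambda_0(G)\le\lambda_0(K(n,k,1))=\lambda_0(K(n,k,n-k-1))$, with equality if and only if $G\cong K(n,k,n-k-1)$ or $G\cong K(n,k,1)$. (ii) For every $\alpha$ with $0<\alpha<1$, $\lambda_\alpha(G)\le\lambda_\alpha(K(n,k,n-k-1))$, with equality if and only if $G\cong K(n,k,n-k-1)$. -/

import Mathlib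

open scoped ENNReal

namespace Digraph

/-- There is a directed walk (equivalently, a directed path) between any two vertices, in both
directions. -/
def StronglyConnected {V : Type*} (G : Digraph V) : Prop :=
  ∀ u v : V, Relation.ReflTransGen G.Adj u v

/-- No loops (parallel arcs are excluded by the type `Digraph`). -/
def IsSimple {V : Type*} (G : Digraph V) : Prop :=
  ∀ v : V, ¬ G.Adj v v

/-- The set of arcs `(u, v)`, with tail `u` and head `v`. -/
def arcSet {V : Type*} (G : Digraph V) : Set (V × V) :=
  {e | G.Adj e.1 e.2}

/-- The digraph `G - S`. -/
def deleteArcs {V : Type*} (G : Digraph V) (S : Set (V × V)) : Digraph V where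
  Adj u v := G.Adj u v ∧ (u, v) ∉ S

/-- The digraph `G + S`. -/
def addArcs {V : Type*} (G : Digraph V) (S : Set (V × V)) : Digraph V where
  Adj u v := G.Adj u v ∨ (u, v) ∈ S

/-- A set of arcs of `G` whose deletion leaves a digraph that is not strongly connected. -/
def IsArcCut {V : Type*} (G : Digraph V) (S : Finset (V × V)) : Prop :=
  (S : Set (V × V)) ⊆ G.arcSet ∧ ¬ (G.deleteArcs S).StronglyConnected

/-- The arc connectivity: the minimum number of arcs whose deletion yields a digraph that is not
strongly connected. An arc cut exists whenever `V` is finite with at least two vertices, so the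
infimum is then a minimum. -/
noncomputable def arcConnectivity {V : Type*} (G : Digraph V) : ℕ :=
  sInf {m : ℕ | ∃ S : Finset (V × V), G.IsArcCut S ∧ S.card = m}

/-- The class of simple strongly connected digraphs with `n` vertices and arc connectivity `k`. -/
structure MemL (n k : ℕ) {V : Type*} [Fintype V] (G : Digraph V) : Prop where
  simple : G.IsSimple
  stronglyConnected : G.StronglyConnected
  card_eq : Fintype.card V = n
  arcConnectivity_eq : G.arcConnectivity = k

/-- Isomorphism of digraphs. -/
def Isomorphic {V W : Type*} (G : Digraph V) (H : Digraph W) : Prop :=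
  Nonempty (G.Adj ≃r H.Adj)

/-- The complete digraph without loops on `p` vertices. -/
def completeSimple (p : ℕ) : Digraph (Fin p) where
  Adj u v := u ≠ v

/-- The disjoint union of two digraphs. -/
def disjointUnion {V W : Type*} (G : Digraph V) (H : Digraph W) : Digraph (V ⊕ W) where
  Adj := Sum.LiftRel G.Adj H.Adj

/-- The join of two digraphs: the disjoint union, together with all arcs, in both directions,
between the two parts. -/
def join {V W : Type*} (G : Digraph V) (H : Digraph W) : Digraph (V ⊕ W) :=
  (disjointUnion G H).addArcs
    ({e | ∃ v w, e = (Sum.inl v, Sum.inr w)} ∪ {e | ∃ v w, e = (Sum.inr w, Sum.inl v)})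

/-- The digraph `K(n,k,m)`: the join of the complete digraph on `k` vertices with the disjoint
union of the complete digraphs on `n-k-m` and on `m` vertices, plus all arcs from the complete
digraph on `m` vertices to the one on `n-k-m` vertices. It is used for `1 ≤ m ≤ n-k-1` only. -/
def K (n k m : ℕ) : Digraph (Fin k ⊕ (Fin (n - k - m) ⊕ Fin m)) :=
  (join (completeSimple k)
    (disjointUnion (completeSimple (n - k - m)) (completeSimple m))).addArcs
    {e | ∃ (u : Fin m) (v : Fin (n - k - m)), e = (Sum.inr (Sum.inr u), Sum.inr (Sum.inl v))}

/-- The number of out-neighbours of a vertex. -/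
noncomputable def outdegree {V : Type*} (G : Digraph V) (v : V) : ℕ :=
  {w | G.Adj v w}.ncard

open Classical in
/-- The adjacency matrix. -/
noncomputable def adjacencyMatrix {V : Type*} (G : Digraph V) : Matrix V V ℝ :=
  Matrix.of fun u v => if G.Adj u v then 1 else 0

/-- The matrix `A_α(G) = α D(G) + (1 - α) A(G)`, where `D(G)` is the diagonal matrix of
outdegrees. -/
noncomputable def alphaMatrix {V : Type*} [DecidableEq V] (α : ℝ) (G : Digraph V) :
    Matrix V V ℝ :=
  α • Matrix.diagonal (fun v => (G.outdegree v : ℝ)) + (1 - α) • G.adjacencyMatrix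

/-- The `A_α` spectral radius: the largest modulus of the complex eigenvalues of `A_α(G)`,
as an extended nonnegative real (which is finite, a matrix having finitely many eigenvalues). -/
noncomputable def alphaSpectralRadius {V : Type*} [Fintype V] [DecidableEq V] (α : ℝ)
    (G : Digraph V) : ℝ≥0∞ :=
  spectralRadius ℂ ((G.alphaMatrix α).map (fun x : ℝ => (x : ℂ)))

end Digraph

/-! Deleting a minimum arc cut leaves a reachable set `X` such that at most `k` arcs of `G` go from
`X` to `Xᶜ`. Let `M v` be the set of vertices of `Xᶜ` that `v ∈ X` misses as out-neighbours, and s_v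
its size, so that ∑ s_v ≥ |X||Xᶜ| - k ≥ S, where S = n-1-k. Vertices of `Xᶜ` miss nothing.

Put C = (1-α)(n-1+y), r = n-2+α+(1-α)y and x_v = 1 - s_v/(C + α s_v). If all arcs outside `M` are
present and ∑ s_v/(C + α s_v) = 1-y, then x is a positive eigenvector for r. Choose y with 1-y =
S/(C + αS). Since t/(C + αt) is increasing and subadditive (`Finset.div_le_sum_div`), the sum is at
least 1-y for every `G`, so A_α x ≤ r x (`mulVec_testVector_le`), and the Collatz–Wielandt bound
gives spectral radius at most r.

In the case of equality, irreducibility makes every row tight: `G` misses exactly the arcs in `M`, ∑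
s_v = S, and either one vertex carries all of S, which gives K(n,k,n-k-1), or α = 0. In the latter
case |X||Xᶜ| ≤ n-1 forces `X` or `Xᶜ` to be a singleton, which gives the two extremal digraphs. -/

/-! ### Spectral radius of nonnegative matrices -/

open Matrix in
theorem Matrix.mem_spectrum_iff_exists_mulVec_eq_smul {V K : Type*} [Fintype V] [DecidableEq V]
    [Field K] {A : Matrix V V K} {μ : K} : μ ∈ spectrum K A ↔ ∃ v, v ≠ 0 ∧ A *ᵥ v = μ • v := by
  rw [spectrum.mem_iff, Matrix.isUnit_iff_isUnit_det, isUnit_iff_ne_zero, not_not,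
    ← Matrix.exists_mulVec_eq_zero_iff]
  refine exists_congr fun v => and_congr_right fun _ => ?_
  rw [Matrix.sub_mulVec, sub_eq_zero, Algebra.algebraMap_eq_smul_one, Matrix.smul_mulVec,
    Matrix.one_mulVec, eq_comm]

open Matrix in
/-- The Collatz–Wielandt upper bound, with its case of equality. -/
theorem Matrix.norm_le_of_mulVec_le {V : Type*} [Fintype V] [DecidableEq V]
    {B : Matrix V V ℝ} (hB : ∀ i j, 0 ≤ B i j) {x : V → ℝ} (hx : ∀ i, 0 < x i) {r : ℝ}
    (h : ∀ i, (B *ᵥ x) i ≤ r * x i) {μ : ℂ}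
    (hμ : μ ∈ spectrum ℂ (B.map (fun t : ℝ => (t : ℂ)))) :
    ‖μ‖ ≤ r ∧ (‖μ‖ = r → (∀ i j, Relation.ReflTransGen (fun a b => 0 < B a b) i j) →
      B *ᵥ x = r • x) := by
  obtain ⟨v, hv0, hv⟩ := Matrix.mem_spectrum_iff_exists_mulVec_eq_smul.1 hμ
  obtain ⟨i₀, hi₀⟩ : ∃ i, v i ≠ 0 := Function.ne_iff.1 hv0
  have key : ∀ i, ‖μ‖ * ‖v i‖ ≤ ∑ j, B i j * ‖v j‖ := by
    intro i
    have h1 : ∑ j, (B i j : ℂ) * v j = μ * v i := by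
      simpa [Matrix.mulVec, dotProduct] using congrFun hv i
    rw [← norm_mul, ← h1]
    refine (norm_sum_le _ _).trans (Finset.sum_le_sum fun j _ => ?_)
    rw [norm_mul, Complex.norm_real, Real.norm_of_nonneg (hB i j)]
  -- The least c with |v| ≤ c x entrywise is attained at `m`; row `m` then yields the bound.
  obtain ⟨m, -, hm⟩ := Finset.exists_max_image Finset.univ (fun i => ‖v i‖ / x i)
    ⟨i₀, Finset.mem_univ _⟩
  set c := ‖v m‖ / x m with hc
  have hle : ∀ i, ‖v i‖ ≤ c * x i := fun i => (div_le_iff₀ (hx i)).1 (hm i (Finset.mem_univ _))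
  have hcpos : 0 < c :=
    lt_of_lt_of_le (div_pos (norm_pos_iff.2 hi₀) (hx i₀)) (hm i₀ (Finset.mem_univ _))
  have step : ∀ i, ∑ j, B i j * ‖v j‖ ≤ c * (B *ᵥ x) i := by
    intro i
    simp only [Matrix.mulVec, dotProduct, Finset.mul_sum]
    refine Finset.sum_le_sum fun j _ => ?_
    calc B i j * ‖v j‖ ≤ B i j * (c * x j) := mul_le_mul_of_nonneg_left (hle j) (hB i j)
      _ = c * (B i j * x j) := by ring
  have hmeq : ‖v m‖ = c * x m := by rw [hc, div_mul_cancel₀ _ (hx m).ne']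
  refine ⟨?_, fun hr hirr => ?_⟩
  · have h1 := (key m).trans ((step m).trans (mul_le_mul_of_nonneg_left (h m) hcpos.le))
    rw [hmeq] at h1
    have h2 : 0 < c * x m := mul_pos hcpos (hx m)
    nlinarith
  · have tight : ∀ i, ‖v i‖ = c * x i →
        (B *ᵥ x) i = r * x i ∧ ∀ j, 0 < B i j → ‖v j‖ = c * x j := by
      intro i hi
      have h1 := key i
      rw [hr, hi] at h1
      have h2 := mul_le_mul_of_nonneg_left (h i) hcpos.le
      have h3 := step i
      refine ⟨mul_left_cancel₀ hcpos.ne' (le_antisymm h2 ?_), fun j hj => ?_⟩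
      · linarith
      · by_contra hne
        have hlt : ‖v j‖ < c * x j := lt_of_le_of_ne (hle j) hne
        have : ∑ j, B i j * ‖v j‖ < ∑ j, B i j * (c * x j) :=
          Finset.sum_lt_sum (fun j _ => mul_le_mul_of_nonneg_left (hle j) (hB i j))
            ⟨j, Finset.mem_univ _, mul_lt_mul_of_pos_left hlt hj⟩
        have h4 : ∑ j, B i j * (c * x j) = c * (B *ᵥ x) i := by
          simp only [Matrix.mulVec, dotProduct, Finset.mul_sum]
          exact Finset.sum_congr rfl fun j _ => by ring
        linarith
    -- Tightness starts at `m` and spreads along positive entries, hence everywhere by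
    -- irreducibility.
    have all : ∀ j, ‖v j‖ = c * x j := by
      intro j
      induction hirr m j with
      | refl => exact hmeq
      | tail _ hbc ih => exact (tight _ ih).2 _ hbc
    funext i
    exact (tight i (all i)).1

theorem Matrix.spectralRadius_le_of_mulVec_le {V : Type*} [Fintype V] [DecidableEq V]
    {B : Matrix V V ℝ} (hB : ∀ i j, 0 ≤ B i j) {x : V → ℝ} (hx : ∀ i, 0 < x i) {r : ℝ}
    (h : ∀ i, (B.mulVec x) i ≤ r * x i) :
    spectralRadius ℂ (B.map (fun t : ℝ => (t : ℂ))) ≤ ENNReal.ofReal r := by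
  refine iSup₂_le fun μ hμ => ?_
  change ‖μ‖ₑ ≤ _
  rw [← ofReal_norm]
  exact ENNReal.ofReal_le_ofReal (Matrix.norm_le_of_mulVec_le hB hx h hμ).1

/-- The spectrum does not depend on a norm; the operator norm only serves to make the matrices a
Banach algebra. -/
theorem Matrix.exists_enorm_eq_spectralRadius {V : Type*} [Fintype V] [DecidableEq V] [Nonempty V]
    (A : Matrix V V ℂ) : ∃ μ ∈ spectrum ℂ A, ‖μ‖ₑ = spectralRadius ℂ A := by
  let := Matrix.linftyOpNormedRing (n := V) (α := ℂ)
  let := Matrix.linftyOpNormedAlgebra (n := V) (R := ℂ) (α := ℂ)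
  have : CompleteSpace (Matrix V V ℂ) := FiniteDimensional.complete ℂ _
  obtain ⟨μ, h, h'⟩ := spectrum.exists_nnnorm_eq_spectralRadius A
  exact ⟨μ, h, h'⟩

theorem Matrix.mulVec_eq_of_spectralRadius_eq {V : Type*} [Fintype V] [DecidableEq V] [Nonempty V]
    {B : Matrix V V ℝ} (hB : ∀ i j, 0 ≤ B i j) {x : V → ℝ} (hx : ∀ i, 0 < x i) {r : ℝ}
    (hr : 0 ≤ r) (h : ∀ i, (B.mulVec x) i ≤ r * x i)
    (hirr : ∀ i j, Relation.ReflTransGen (fun a b => 0 < B a b) i j)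
    (heq : spectralRadius ℂ (B.map (fun t : ℝ => (t : ℂ))) = ENNReal.ofReal r) :
    B.mulVec x = r • x := by
  obtain ⟨μ, hμ, hμr⟩ := Matrix.exists_enorm_eq_spectralRadius (B.map (fun t : ℝ => (t : ℂ)))
  rw [heq, ← ofReal_norm, ENNReal.ofReal_eq_ofReal_iff (norm_nonneg _) hr] at hμr
  exact (Matrix.norm_le_of_mulVec_le hB hx h hμ).2 hμr hirr

theorem Matrix.spectralRadius_eq_of_mulVec_eq {V : Type*} [Fintype V] [DecidableEq V] [Nonempty V]
    {B : Matrix V V ℝ} (hB : ∀ i j, 0 ≤ B i j) {x : V → ℝ} (hx : ∀ i, 0 < x i) {r : ℝ}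
    (hr : 0 ≤ r) (h : B.mulVec x = r • x) :
    spectralRadius ℂ (B.map (fun t : ℝ => (t : ℂ))) = ENNReal.ofReal r := by
  refine le_antisymm (Matrix.spectralRadius_le_of_mulVec_le hB hx fun i => (congrFun h i).le) ?_
  have hmem : (r : ℂ) ∈ spectrum ℂ (B.map (fun t : ℝ => (t : ℂ))) := by
    refine Matrix.mem_spectrum_iff_exists_mulVec_eq_smul.2 ⟨fun i => (x i : ℂ), ?_, ?_⟩
    · obtain ⟨i⟩ := ‹Nonempty V›
      exact Function.ne_iff.2 ⟨i, by simpa using (hx i).ne'⟩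
    · funext i
      have h1 : ∑ j, B i j * x j = r * x i := by
        simpa [Matrix.mulVec, dotProduct] using congrFun h i
      have h2 : ((∑ j, B i j * x j : ℝ) : ℂ) = ((r * x i : ℝ) : ℂ) := by rw [h1]
      simpa [Matrix.mulVec, dotProduct] using h2
  have h3 : ENNReal.ofReal r = ‖(r : ℂ)‖ₑ := by
    rw [← ofReal_norm, Complex.norm_real, Real.norm_of_nonneg hr]
  rw [h3]
  exact le_iSup₂ (f := fun (μ : ℂ) (_ : μ ∈ spectrum ℂ (B.map (fun t : ℝ => (t : ℂ)))) =>
    (‖μ‖ₑ : ℝ≥0∞)) _ hmem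

/-! ### Subadditivity of t/(C + αt) -/

/-- The function t/(C + αt) is increasing and vanishes at 0. If some term has s v ≥ S, it suffices
alone. Otherwise replacing each denominator by the larger C + αS makes the sum linear; that
replacement is strict at a term with 0 < s v < S unless α = 0. -/
theorem Finset.div_le_sum_div {V : Type*} [Fintype V] {α C : ℝ} (hα : 0 ≤ α) (hC : 0 < C)
    (s : V → ℕ) {S : ℕ} (hS : 1 ≤ S) (hsum : S ≤ ∑ v, s v) :
    (S : ℝ) / (C + α * S) ≤ ∑ v, (s v : ℝ) / (C + α * s v) ∧
      ((S : ℝ) / (C + α * S) = ∑ v, (s v : ℝ) / (C + α * s v) →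
        ∑ v, s v = S ∧ (α = 0 ∨ ∃ v, s v = S)) := by
  have hden : ∀ t : ℕ, 0 < C + α * t := fun t => by positivity
  have hnn : ∀ t : ℕ, 0 ≤ (t : ℝ) / (C + α * t) := fun t => div_nonneg t.cast_nonneg (hden t).le
  have hmono : ∀ a b : ℕ, a < b → (a : ℝ) / (C + α * a) < b / (C + α * b) := by
    intro a b hab
    have hab' : (a : ℝ) < b := by exact_mod_cast hab
    rw [div_lt_div_iff₀ (hden a) (hden b)]
    nlinarith
  classical
  by_cases hbig : ∃ v, S ≤ s v
  · obtain ⟨v, hv⟩ := hbig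
    have h1 : (S : ℝ) / (C + α * S) ≤ s v / (C + α * s v) := by
      rcases hv.lt_or_eq with h | h
      · exact (hmono _ _ h).le
      · rw [h]
    have h2 : ∑ w, (s w : ℝ) / (C + α * s w) =
        s v / (C + α * s v) + ∑ w ∈ Finset.univ.erase v, (s w : ℝ) / (C + α * s w) :=
      (Finset.add_sum_erase _ _ (Finset.mem_univ v)).symm
    have h3 : 0 ≤ ∑ w ∈ Finset.univ.erase v, (s w : ℝ) / (C + α * s w) :=
      Finset.sum_nonneg fun w _ => hnn _
    refine ⟨by linarith, fun heq => ?_⟩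
    have hvS : s v = S := by
      by_contra hne
      have := hmono _ _ (lt_of_le_of_ne hv (Ne.symm hne))
      linarith
    have h4 : ∑ w ∈ Finset.univ.erase v, (s w : ℝ) / (C + α * s w) = 0 := by
      rw [hvS] at h2; linarith
    rw [Finset.sum_eq_zero_iff_of_nonneg fun w _ => hnn _] at h4
    refine ⟨?_, .inr ⟨v, hvS⟩⟩
    rw [← hvS]
    refine Finset.sum_eq_single v (fun w _ hw => ?_) (by simp)
    have h5 := h4 w (Finset.mem_erase.2 ⟨hw, Finset.mem_univ _⟩)
    rcases div_eq_zero_iff.1 h5 with h | h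
    · exact_mod_cast h
    · exact ((hden _).ne' h).elim
  · push Not at hbig
    have h1 : ∀ v, (s v : ℝ) / (C + α * S) ≤ s v / (C + α * s v) := by
      intro v
      have : (s v : ℝ) ≤ S := by exact_mod_cast (hbig v).le
      exact div_le_div_of_nonneg_left (Nat.cast_nonneg _) (hden _) (by gcongr)
    have h2 : (S : ℝ) / (C + α * S) ≤ (∑ v, s v : ℕ) / (C + α * S) :=
      div_le_div_of_nonneg_right (by exact_mod_cast hsum) (hden S).le
    have h3 : ((∑ v, s v : ℕ) : ℝ) / (C + α * S) = ∑ v, (s v : ℝ) / (C + α * S) := by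
      rw [Nat.cast_sum, Finset.sum_div]
    have h4 := Finset.sum_le_sum fun v (_ : v ∈ Finset.univ) => h1 v
    refine ⟨by linarith, fun heq => ⟨?_, .inl ?_⟩⟩
    · have h5 : (S : ℝ) / (C + α * S) = (∑ v, s v : ℕ) / (C + α * S) := by linarith
      rw [div_left_inj' (hden S).ne'] at h5
      exact_mod_cast h5.symm
    · obtain ⟨v, hv⟩ : ∃ v, 0 < s v := by
        by_contra! hall
        have : ∑ v, s v = 0 := Finset.sum_eq_zero fun v _ => by have := hall v; omega
        omega
      have h6 := (Finset.sum_eq_sum_iff_of_le fun v (_ : v ∈ Finset.univ) => h1 v).1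
        (by linarith) v (Finset.mem_univ v)
      have hv' : (0 : ℝ) < s v := by exact_mod_cast hv
      rw [div_eq_div_iff (hden _).ne' (hden _).ne'] at h6
      have h7 : α * (s v : ℝ) = α * S := by
        have := mul_left_cancel₀ hv'.ne' h6
        linarith
      by_contra hα0
      have h8 : (s v : ℝ) = S := mul_left_cancel₀ hα0 h7
      have := hbig v
      have : s v = S := by exact_mod_cast h8
      omega

/-! ### The matrix A_α and its test vector -/

namespace Digraph

theorem alphaMatrix_mulVec_apply {V : Type*} [Fintype V] [DecidableEq V] (G : Digraph V)
    [DecidableRel G.Adj] (α : ℝ) (x : V → ℝ) (v : V) :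
    ((G.alphaMatrix α).mulVec x) v =
      α * (Finset.univ.filter (G.Adj v)).card * x v +
        (1 - α) * ∑ w ∈ Finset.univ.filter (G.Adj v), x w := by
  have h : G.outdegree v = (Finset.univ.filter (G.Adj v)).card := by
    rw [outdegree, ← Set.ncard_coe_finset]; simp
  rw [alphaMatrix, Matrix.add_mulVec, Pi.add_apply, Matrix.smul_mulVec, Matrix.smul_mulVec,
    Pi.smul_apply, Pi.smul_apply, Matrix.mulVec_diagonal, h, smul_eq_mul, smul_eq_mul, mul_assoc,
    Finset.sum_filter]
  congr 2
  simp only [Matrix.mulVec, dotProduct, adjacencyMatrix, Matrix.of_apply]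
  exact Finset.sum_congr rfl fun w _ => by by_cases hw : G.Adj v w <;> simp [hw]

theorem alphaMatrix_nonneg {V : Type*} [DecidableEq V] (G : Digraph V) {α : ℝ} (hα : 0 ≤ α)
    (hα1 : α < 1) (i j : V) : 0 ≤ G.alphaMatrix α i j := by
  have h1 : 0 ≤ 1 - α := by linarith
  by_cases hij : i = j <;> by_cases h : G.Adj i j <;>
    simp [alphaMatrix, adjacencyMatrix, hij, h] <;> first | positivity | exact hα1.le

theorem alphaMatrix_pos_of_adj {V : Type*} [DecidableEq V] {G : Digraph V} {α : ℝ} (hα : 0 ≤ α)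
    (hα1 : α < 1) {i j : V} (h : G.Adj i j) : 0 < G.alphaMatrix α i j := by
  have h1 : 0 < 1 - α := by linarith
  by_cases hij : i = j
  · subst hij
    simp [alphaMatrix, adjacencyMatrix, h]
    positivity
  · simp [alphaMatrix, adjacencyMatrix, hij, h, h1]

theorem StronglyConnected.reflTransGen_alphaMatrix {V : Type*} [DecidableEq V] {G : Digraph V}
    (h : G.StronglyConnected) {α : ℝ} (hα : 0 ≤ α) (hα1 : α < 1) (i j : V) :
    Relation.ReflTransGen (fun a b => 0 < G.alphaMatrix α a b) i j :=
  Relation.ReflTransGen.mono (fun _ _ hab => alphaMatrix_pos_of_adj hα hα1 hab) _ _ (h i j)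

/-- The test vector attached to a family of sets of missing out-neighbours. -/
noncomputable def testVector {V : Type*} (M : V → Finset V) (α C : ℝ) (v : V) : ℝ :=
  1 - ((M v).card : ℝ) / (C + α * (M v).card)

section Rows

variable {V : Type*} [Fintype V] {M : V → Finset V} {α y : ℝ}

/-- With s = |M v| ≤ n-1, the numerator C + αs - s equals (1-α)(n-1+y-s), which is positive because
y > 0. -/
theorem testVector_pos (hα : 0 ≤ α) (hα1 : α < 1) (hy : 0 < y)
    (hself : ∀ v, v ∉ M v) (v : V) :
    0 < testVector M α ((1 - α) * (Fintype.card V - 1 + y)) v := by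
  have h1 : ((M v).card : ℝ) + 1 ≤ Fintype.card V := by
    exact_mod_cast Finset.card_lt_univ_of_notMem (hself v)
  have h2 : (0 : ℝ) ≤ (M v).card := Nat.cast_nonneg _
  have h3 : 0 < (1 - α) * (Fintype.card V - 1 + y - (M v).card) := by
    apply mul_pos <;> linarith
  have h4 : 0 ≤ α * (M v).card := by positivity
  rw [testVector, sub_pos, div_lt_one (by nlinarith)]
  nlinarith

/-- Collecting the terms in x, the row equation reads x(C + αs) = C + αs - s; this is where the form
of the test vector comes from. -/
theorem testVector_identity (hα : 0 ≤ α) (hα1 : α < 1) (hy : 0 < y)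
    (v : V) {x : ℝ} (hx : x = testVector M α ((1 - α) * (Fintype.card V - 1 + y)) v) :
    α * (Fintype.card V - 1 - (M v).card) * x +
        (1 - α) * (Fintype.card V - (1 - y) - x - (M v).card) =
      (Fintype.card V - 2 + α + (1 - α) * y) * x := by
  have h1 : (1 : ℝ) ≤ Fintype.card V := by
    exact_mod_cast Fintype.card_pos_iff.2 ⟨v⟩
  have h3 : 0 < (1 - α) * (Fintype.card V - 1 + y) := by apply mul_pos <;> linarith
  have h4 : 0 < (1 - α) * (Fintype.card V - 1 + y) + α * (M v).card := by positivity
  have h5 : x * ((1 - α) * (Fintype.card V - 1 + y) + α * (M v).card) =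
      (1 - α) * (Fintype.card V - 1 + y) + α * (M v).card - (M v).card := by
    rw [hx, testVector, sub_mul, div_mul_cancel₀ _ h4.ne', one_mul]
  linear_combination -h5

variable [DecidableEq V]

/-- By `htrans` every missing out-neighbour has weight exactly 1, so removing `M v` from the total
costs |M v|. -/
theorem sum_testVector_allowed {C : ℝ} (hself : ∀ v, v ∉ M v) (htrans : ∀ v, ∀ w ∈ M v, M w = ∅)
    (v : V) :
    ∑ w ∈ Finset.univ.erase v \ M v, testVector M α C w =
      Fintype.card V - ∑ w, ((M w).card : ℝ) / (C + α * (M w).card) - testVector M α C v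
        - (M v).card := by
  have hsub : M v ⊆ Finset.univ.erase v := fun w hw =>
    Finset.mem_erase.2 ⟨fun h => hself v (h ▸ hw), Finset.mem_univ _⟩
  have h1 := Finset.sum_sdiff (f := testVector M α C) hsub
  have h2 := Finset.add_sum_erase Finset.univ (testVector M α C) (Finset.mem_univ v)
  have h3 : ∑ w ∈ M v, testVector M α C w = (M v).card := by
    rw [Finset.sum_congr rfl fun w hw => show testVector M α C w = 1 by
      simp [testVector, htrans v w hw]]
    simp
  have h4 : ∑ w, testVector M α C w =
      Fintype.card V - ∑ w, ((M w).card : ℝ) / (C + α * (M w).card) := by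
    simp [testVector, Finset.sum_sub_distrib]
  linarith

theorem card_allowed (hself : ∀ v, v ∉ M v) (v : V) :
    ((Finset.univ.erase v \ M v).card : ℝ) = Fintype.card V - 1 - (M v).card := by
  have hsub : M v ⊆ Finset.univ.erase v := fun w hw =>
    Finset.mem_erase.2 ⟨fun h => hself v (h ▸ hw), Finset.mem_univ _⟩
  have h1 := Finset.card_sdiff_add_card_eq_card hsub
  have h2 := Finset.card_erase_add_one (Finset.mem_univ v)
  rw [Finset.card_univ] at h2
  have h3 : ((Finset.univ.erase v \ M v).card : ℝ) + (M v).card + 1 = Fintype.card V := by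
    exact_mod_cast (by omega)
  linarith

variable {G : Digraph V} [DecidableRel G.Adj]

/-- Each row is compared with the row in which only the arcs of `M` are absent. Losing a further arc
is strict because the weights are positive, and so is slack in `hsum`. -/
theorem mulVec_testVector_le (hα : 0 ≤ α) (hα1 : α < 1) (hy : 0 < y)
    (hself : ∀ v, v ∉ M v) (htrans : ∀ v, ∀ w ∈ M v, M w = ∅)
    (hG : ∀ v w, G.Adj v w → w ≠ v ∧ w ∉ M v)
    (hsum : 1 - y ≤ ∑ w, ((M w).card : ℝ) /
      ((1 - α) * (Fintype.card V - 1 + y) + α * (M w).card)) (v : V) :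
    let x := testVector M α ((1 - α) * (Fintype.card V - 1 + y))
    (G.alphaMatrix α).mulVec x v ≤ (Fintype.card V - 2 + α + (1 - α) * y) * x v ∧
    ((G.alphaMatrix α).mulVec x v = (Fintype.card V - 2 + α + (1 - α) * y) * x v →
      1 - y = ∑ w, ((M w).card : ℝ) /
        ((1 - α) * (Fintype.card V - 1 + y) + α * (M w).card) ∧
      ∀ w, w ≠ v → w ∉ M v → G.Adj v w) := by
  intro x
  have hpos : ∀ w, 0 < x w := testVector_pos hα hα1 hy hself
  have hsub : Finset.univ.filter (G.Adj v) ⊆ Finset.univ.erase v \ M v := fun w hw => by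
    simpa using hG v w (Finset.mem_filter.1 hw).2
  have h1 := sum_testVector_allowed (α := α) (C := (1 - α) * (Fintype.card V - 1 + y))
    hself htrans v
  have h2 : ((Finset.univ.filter (G.Adj v)).card : ℝ) ≤ Fintype.card V - 1 - (M v).card := by
    rw [← card_allowed hself v]
    exact_mod_cast Finset.card_le_card hsub
  have h3 : ∑ w ∈ Finset.univ.filter (G.Adj v), x w ≤ ∑ w ∈ Finset.univ.erase v \ M v, x w :=
    Finset.sum_le_sum_of_subset_of_nonneg hsub fun w _ _ => (hpos w).le
  have h4 := testVector_identity (M := M) hα hα1 hy v (x := x v) rfl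
  have h5 : α * (Finset.univ.filter (G.Adj v)).card * x v ≤
      α * (Fintype.card V - 1 - (M v).card) * x v :=
    mul_le_mul_of_nonneg_right (mul_le_mul_of_nonneg_left h2 hα) (hpos v).le
  have hα' : 0 < 1 - α := by linarith
  rw [alphaMatrix_mulVec_apply]
  change ∑ w ∈ Finset.univ.erase v \ M v, x w = Fintype.card V - _ - x v - (M v).card at h1
  have h6 : ∑ w ∈ Finset.univ.erase v \ M v, x w ≤
      Fintype.card V - (1 - y) - x v - (M v).card := by linarith
  have h7 := mul_le_mul_of_nonneg_left (h3.trans h6) hα'.le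
  refine ⟨by linarith, fun heq => ?_⟩
  have h8 : ∑ w ∈ Finset.univ.filter (G.Adj v), x w =
      Fintype.card V - (1 - y) - x v - (M v).card :=
    mul_left_cancel₀ hα'.ne' (by linarith)
  refine ⟨by linarith, fun w hw hwM => ?_⟩
  by_contra hadj
  have h9 : ∑ w ∈ Finset.univ.filter (G.Adj v), x w < ∑ w ∈ Finset.univ.erase v \ M v, x w :=
    Finset.sum_lt_sum_of_subset hsub (i := w) (by simp [hw, hwM]) (by simp [hadj]) (hpos w)
      fun w _ _ => (hpos w).le
  linarith

theorem mulVec_testVector_eq (hα : 0 ≤ α) (hα1 : α < 1) (hy : 0 < y)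
    (hself : ∀ v, v ∉ M v) (htrans : ∀ v, ∀ w ∈ M v, M w = ∅)
    (hG : ∀ v w, G.Adj v w ↔ w ≠ v ∧ w ∉ M v)
    (hsum : 1 - y = ∑ w, ((M w).card : ℝ) /
      ((1 - α) * (Fintype.card V - 1 + y) + α * (M w).card)) :
    let x := testVector M α ((1 - α) * (Fintype.card V - 1 + y))
    (G.alphaMatrix α).mulVec x = ((Fintype.card V : ℝ) - 2 + α + (1 - α) * y) • x := by
  intro x
  funext v
  have hN : Finset.univ.filter (G.Adj v) = Finset.univ.erase v \ M v := by
    ext w; simp [hG]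
  rw [alphaMatrix_mulVec_apply, hN, card_allowed hself, sum_testVector_allowed hself htrans, ← hsum]
  exact testVector_identity hα hα1 hy v rfl

end Rows

theorem exists_quadratic_root {n k : ℕ} (hk : 1 ≤ k) (hkn : k + 2 ≤ n) {α : ℝ}
    (hα : 0 ≤ α) (hα1 : α < 1) :
    ∃ y : ℝ, 0 < y ∧ 1 - y =
      ((n - 1 - k : ℕ) : ℝ) / ((1 - α) * (n - 1 + y) + α * (n - 1 - k : ℕ)) := by
  have hk' : (1 : ℝ) ≤ k := by exact_mod_cast hk
  have hkn' : (k : ℝ) + 2 ≤ n := by exact_mod_cast hkn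
  have hcast : ((n - 1 - k : ℕ) : ℝ) = n - 1 - k := by
    rw [Nat.cast_sub (by omega), Nat.cast_sub (by omega), Nat.cast_one]
  -- The equation with denominators cleared: the quadratic is -(1-α)k < 0 at 0 and n-1-k > 0 at 1.
  obtain ⟨y, ⟨hy0, -⟩, hy⟩ := intermediate_value_Ioo (zero_le_one' ℝ)
    (f := fun y : ℝ => y * (n - 2 + α + (1 - α) * y - α * k) - (1 - α) * k) (by fun_prop)
    (show (0 : ℝ) ∈ Set.Ioo _ _ from ⟨by nlinarith, by nlinarith⟩)
  refine ⟨y, hy0, ?_⟩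
  have h1 : 0 < (1 - α) * (n - 1 + y) := by apply mul_pos <;> linarith
  have h2 : 0 ≤ α * ((n - 1 - k : ℕ) : ℝ) := by positivity
  rw [eq_div_iff (by linarith), hcast]
  simp only at hy
  linear_combination -hy

end Digraph

/-! ### Isomorphisms, and the arc connectivity of K(n,k,m) -/

namespace Digraph

theorem isomorphic_of_label {V W ι : Type*} [Fintype V] [Fintype W] [DecidableEq ι]
    {G : Digraph V} {H : Digraph W} (c : V → ι) (d : W → ι) (R : ι → ι → Prop)
    (hG : ∀ u v, G.Adj u v ↔ u ≠ v ∧ R (c u) (c v))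
    (hH : ∀ u v, H.Adj u v ↔ u ≠ v ∧ R (d u) (d v))
    (hcard : ∀ i, Fintype.card {v // c v = i} = Fintype.card {w // d w = i}) :
    G.Isomorphic H := by
  let e : V ≃ W := (Equiv.sigmaFiberEquiv c).symm.trans
    ((Equiv.sigmaCongrRight fun i => Fintype.equivOfCardEq (hcard i)).trans
      (Equiv.sigmaFiberEquiv d))
  have he : ∀ v, d (e v) = c v := fun v => (Fintype.equivOfCardEq (hcard (c v)) ⟨v, rfl⟩).2
  refine ⟨⟨e, fun {a b} => ?_⟩⟩
  rw [hG, hH, he, he, e.injective.ne_iff]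

theorem alphaSpectralRadius_eq_of_isomorphic {V W : Type*} [Fintype V] [Fintype W] [DecidableEq V]
    [DecidableEq W] {G : Digraph V} {H : Digraph W} (h : G.Isomorphic H) (α : ℝ) :
    G.alphaSpectralRadius α = H.alphaSpectralRadius α := by
  obtain ⟨e⟩ := h
  have hadj : ∀ a b, H.Adj (e a) (e b) ↔ G.Adj a b := fun a b => e.map_rel_iff
  have hdeg : ∀ v, H.outdegree (e v) = G.outdegree v := by
    intro v
    rw [outdegree, outdegree, ← Set.ncard_image_of_injective {w | G.Adj v w} e.injective]
    congr 1
    ext w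
    obtain ⟨w, rfl⟩ := e.surjective w
    simp [hadj]
  have hM : (H.alphaMatrix α).map (fun x : ℝ => (x : ℂ)) =
      Matrix.reindexAlgEquiv ℂ ℂ e.toEquiv ((G.alphaMatrix α).map (fun x : ℝ => (x : ℂ))) := by
    ext i j
    obtain ⟨i, rfl⟩ := e.surjective i
    obtain ⟨j, rfl⟩ := e.surjective j
    have h1 : e.toEquiv.symm (e i) = i := e.toEquiv.symm_apply_apply i
    have h2 : e.toEquiv.symm (e j) = j := e.toEquiv.symm_apply_apply j
    by_cases h3 : G.Adj i j <;>
      simp [alphaMatrix, adjacencyMatrix, Matrix.diagonal_apply, h1, h2, hadj, hdeg,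
        e.injective.eq_iff, h3]
  unfold alphaSpectralRadius spectralRadius
  rw [hM, AlgEquiv.spectrum_eq]

/-- The three parts of `K n k m`, in the order of its vertex type. -/
def partLabel {A B C : Type*} : A ⊕ (B ⊕ C) → Fin 3
  | .inl _ => 0
  | .inr (.inl _) => 1
  | .inr (.inr _) => 2

theorem K_adj (n k m : ℕ) (u v : Fin k ⊕ (Fin (n - k - m) ⊕ Fin m)) :
    (K n k m).Adj u v ↔ u ≠ v ∧ ¬ (partLabel u = 1 ∧ partLabel v = 2) := by
  rcases u with u | u | u <;> rcases v with v | v | v <;>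
    simp [K, join, disjointUnion, addArcs, completeSimple, partLabel]

theorem card_partLabel (n k m : ℕ) (i : Fin 3) :
    (Finset.univ.filter fun v : Fin k ⊕ (Fin (n - k - m) ⊕ Fin m) => partLabel v = i).card =
      ![k, n - k - m, m] i := by
  rw [Finset.card_filter]
  fin_cases i <;> simp [Fintype.sum_sum_type, partLabel]

/-- Each of the `k` universal vertices contributes its own arc out of a reachable set `X`: to `y ∉
X` if it lies in `X`, from `x ∈ X` otherwise. Hence a cut has at least `k` arcs. -/
theorem K_stronglyConnected_deleteArcs {n k m : ℕ} (hm : 1 ≤ n - k - m)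
    {S : Finset ((Fin k ⊕ (Fin (n - k - m) ⊕ Fin m)) × (Fin k ⊕ (Fin (n - k - m) ⊕ Fin m)))}
    (hS : S.card < k) : ((K n k m).deleteArcs S).StronglyConnected := by
  intro u v
  by_contra huv
  set X := {w | Relation.ReflTransGen ((K n k m).deleteArcs S).Adj u w} with hX
  have hcut : ∀ a b, a ∈ X → b ∉ X → (K n k m).Adj a b → (a, b) ∈ S := by
    intro a b ha hb hab
    by_contra hS'
    exact hb (Relation.ReflTransGen.tail ha ⟨hab, by simpa using hS'⟩)
  -- One of `x`, `y` is not universal, so an arc (i, y) never coincides with an arc (x, j).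
  obtain ⟨x, y, hx, hy, hxy⟩ : ∃ x y, x ∈ X ∧ y ∉ X ∧ (partLabel x = 1 ∨ partLabel y = 1) := by
    let o : Fin k ⊕ (Fin (n - k - m) ⊕ Fin m) := .inr (.inl ⟨0, hm⟩)
    by_cases ho : o ∈ X
    · exact ⟨o, v, ho, huv, .inl rfl⟩
    · exact ⟨u, o, Relation.ReflTransGen.refl, ho, .inr rfl⟩
  classical
  let f : Fin k → (Fin k ⊕ (Fin (n - k - m) ⊕ Fin m)) × (Fin k ⊕ (Fin (n - k - m) ⊕ Fin m)) :=
    fun i => if Sum.inl i ∈ X then (Sum.inl i, y) else (x, Sum.inl i)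
  have hf : ∀ i, f i ∈ S := by
    intro i
    by_cases hi : Sum.inl i ∈ X
    · simp only [f, hi, if_true]
      exact hcut _ _ hi hy ((K_adj ..).2 ⟨fun h => hy (h ▸ hi), by simp [partLabel]⟩)
    · simp only [f, hi, if_false]
      exact hcut _ _ hx hi ((K_adj ..).2 ⟨fun h => hi (h ▸ hx), by simp [partLabel]⟩)
  have hinj : Function.Injective f := by
    intro i j hij
    by_cases hi : Sum.inl i ∈ X <;> by_cases hj : Sum.inl j ∈ X <;>
      simp only [f, hi, hj, if_true, if_false, Prod.mk.injEq] at hij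
    · exact Sum.inl.inj hij.1
    · rcases hxy with h | h
      · simp [← hij.1, partLabel] at h
      · simp [hij.2, partLabel] at h
    · rcases hxy with h | h
      · simp [hij.1, partLabel] at h
      · simp [← hij.2, partLabel] at h
    · exact Sum.inl.inj hij.2
  have := Finset.card_le_card_of_injOn f (s := Finset.univ) (t := S) (fun i _ => hf i)
    hinj.injOn
  simp at this
  omega

theorem K_memL {n k m : ℕ} (hk : 1 ≤ k) (hkm : k + m ≤ n) (hm : 1 ≤ n - k - m)
    {S : Finset ((Fin k ⊕ (Fin (n - k - m) ⊕ Fin m)) × (Fin k ⊕ (Fin (n - k - m) ⊕ Fin m)))}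
    (hS : (K n k m).IsArcCut S) (hcard : S.card = k) : MemL n k (K n k m) where
  simple v h := ((K_adj ..).1 h).1 rfl
  stronglyConnected u v := by
    have := K_stronglyConnected_deleteArcs hm (S := ∅) (by rw [Finset.card_empty]; omega) u v
    exact Relation.ReflTransGen.mono (fun a b h => h.1) _ _ this
  card_eq := by simp; omega
  arcConnectivity_eq := by
    refine le_antisymm (Nat.sInf_le ⟨S, hS, hcard⟩) (le_csInf ⟨_, S, hS, hcard⟩ ?_)
    rintro _ ⟨T, hT, rfl⟩
    by_contra hlt
    exact hT.2 (K_stronglyConnected_deleteArcs hm (not_le.1 hlt))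

/-- The single vertex of the last part has only the `k` universal in-neighbours, and the arcs from
them form a cut. -/
theorem K_memL_one {n k : ℕ} (hk : 1 ≤ k) (hkn : k + 2 ≤ n) : MemL n k (K n k 1) := by
  let p : Fin k ⊕ (Fin (n - k - 1) ⊕ Fin 1) := .inr (.inr 0)
  have hp : ∀ u, (K n k 1).Adj u p → ∃ i, u = Sum.inl i := by
    intro u hu
    rw [K_adj] at hu
    rcases u with u | u | u
    · exact ⟨u, rfl⟩
    · exact (hu.2 ⟨rfl, rfl⟩).elim
    · exact (hu.1 (by simp only [p, Subsingleton.elim u 0])).elim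
  refine K_memL hk (by omega) (by omega)
    (S := Finset.univ.image fun i : Fin k => (Sum.inl i, p))
    ⟨?_, fun h => ?_⟩
    (by rw [Finset.card_image_of_injective _ fun i j h => by simpa using h, Finset.card_fin])
  · intro e he
    obtain ⟨i, rfl⟩ : ∃ i : Fin k, (Sum.inl i, p) = e := by simpa using he
    exact (K_adj ..).2 ⟨by simp [p], by simp [partLabel]⟩
  · rcases Relation.ReflTransGen.cases_tail (h (Sum.inl ⟨0, hk⟩) p) with h | ⟨u, -, h1, h2⟩
    · simp [p] at h
    · obtain ⟨i, rfl⟩ := hp u h1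
      exact h2 (by simp)

/-- Here the middle part is a single vertex, whose only out-neighbours are the `k` universal
vertices. -/
theorem K_memL_sub {n k : ℕ} (hk : 1 ≤ k) (hkn : k + 2 ≤ n) :
    MemL n k (K n k (n - k - 1)) := by
  have h1 : n - k - (n - k - 1) = 1 := by omega
  let p : Fin k ⊕ (Fin (n - k - (n - k - 1)) ⊕ Fin (n - k - 1)) := .inr (.inl ⟨0, by omega⟩)
  have hp : ∀ u, (K n k (n - k - 1)).Adj p u → ∃ i, u = Sum.inl i := by
    intro u hu
    rw [K_adj] at hu
    rcases u with u | u | u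
    · exact ⟨u, rfl⟩
    · refine (hu.1 ?_).elim
      have : u = ⟨0, by omega⟩ := Fin.ext (by have := u.2; simp; omega)
      simp only [p, this]
    · exact (hu.2 ⟨rfl, rfl⟩).elim
  refine K_memL hk (by omega) (by omega)
    (S := Finset.univ.image fun i : Fin k => (p, Sum.inl i))
    ⟨?_, fun h => ?_⟩
    (by rw [Finset.card_image_of_injective _ fun i j h => by simpa using h, Finset.card_fin])
  · intro e he
    obtain ⟨i, rfl⟩ : ∃ i : Fin k, (p, Sum.inl i) = e := by simpa using he
    exact (K_adj ..).2 ⟨by simp [p], by simp [partLabel]⟩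
  · rcases Relation.ReflTransGen.cases_head (h p (Sum.inl ⟨0, hk⟩)) with h | ⟨u, ⟨h1, h2⟩, -⟩
    · simp [p] at h
    · obtain ⟨i, rfl⟩ := hp u h1
      exact h2 (by simp)

theorem isomorphic_K_of_label {V : Type*} [Fintype V] {G : Digraph V} {n k m : ℕ}
    (hkm : k + m ≤ n) (hV : Fintype.card V = n) (c : V → Fin 3)
    (h1 : (Finset.univ.filter fun v => c v = 1).card = n - k - m)
    (h2 : (Finset.univ.filter fun v => c v = 2).card = m)
    (hG : ∀ u v, G.Adj u v ↔ u ≠ v ∧ ¬ (c u = 1 ∧ c v = 2)) :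
    G.Isomorphic (K n k m) := by
  refine isomorphic_of_label c partLabel (fun i j => ¬ (i = 1 ∧ j = 2)) hG (K_adj n k m) ?_
  intro i
  rw [Fintype.card_subtype, Fintype.card_subtype, card_partLabel]
  have hsum : Fintype.card V = ∑ i, (Finset.univ.filter fun v => c v = i).card :=
    Finset.card_eq_sum_card_fiberwise fun _ _ => Finset.mem_univ _
  rw [Fin.sum_univ_three, h1, h2, hV] at hsum
  fin_cases i
  · simp; omega
  · simpa using h1
  · simpa using h2

end Digraph

/-! ### Missing arcs across a cut, and the extremal digraphs -/

namespace Digraph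

theorem MemL.exists_cut {n k : ℕ} (hk : 1 ≤ k) {V : Type*} [Fintype V] [DecidableEq V]
    {G : Digraph V} [DecidableRel G.Adj] (h : G.MemL n k) : ∃ X : Finset V, X.Nonempty ∧ Xᶜ.Nonempty ∧
      ((X ×ˢ Xᶜ).filter fun e => G.Adj e.1 e.2).card ≤ k := by
  classical
  -- Without any cut the infimum would take the default value 0, contradicting k ≥ 1.
  have hne : {m : ℕ | ∃ S : Finset (V × V), G.IsArcCut S ∧ S.card = m}.Nonempty := by
    by_contra hemp
    have h0 := h.arcConnectivity_eq
    rw [arcConnectivity, Set.not_nonempty_iff_eq_empty.1 hemp, Nat.sInf_empty] at h0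
    omega
  obtain ⟨S, ⟨-, hS⟩, hcard⟩ := Nat.sInf_mem hne
  have hcard' : S.card = k := hcard.trans h.arcConnectivity_eq
  simp only [StronglyConnected, not_forall] at hS
  obtain ⟨u, v, huv⟩ := hS
  refine ⟨Finset.univ.filter fun w => Relation.ReflTransGen (G.deleteArcs S).Adj u w,
    ⟨u, by simpa using Relation.ReflTransGen.refl⟩, ⟨v, by simpa using huv⟩, ?_⟩
  rw [← hcard']
  refine Finset.card_le_card fun e he => ?_
  simp only [Finset.mem_filter, Finset.mem_product, Finset.mem_compl, Finset.mem_univ,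
    true_and] at he
  by_contra heS
  exact he.1.2 (Relation.ReflTransGen.tail he.1.1 ⟨he.2, by simpa using heS⟩)

theorem MemL.exists_missing {n k : ℕ} (hk : 1 ≤ k) {V : Type*} [Fintype V] [DecidableEq V]
    {G : Digraph V} (h : G.MemL n k) : ∃ (X : Finset V) (M : V → Finset V),
      X.Nonempty ∧ Xᶜ.Nonempty ∧ (∀ v w, w ∈ M v → v ∈ X ∧ w ∉ X) ∧
      (∀ v w, G.Adj v w → w ≠ v ∧ w ∉ M v) ∧
      X.card * Xᶜ.card ≤ ∑ v, (M v).card + k := by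
  classical
  obtain ⟨X, hX, hXc, hcut⟩ := h.exists_cut hk
  refine ⟨X, fun v => Finset.univ.filter fun w => v ∈ X ∧ w ∉ X ∧ ¬ G.Adj v w, hX, hXc,
    fun v w hw => ?_, fun v w hvw => ⟨?_, by simp [hvw]⟩, ?_⟩
  · simp only [Finset.mem_filter] at hw
    exact ⟨hw.2.1, hw.2.2.1⟩
  · rintro rfl
    exact h.simple _ hvw
  · have h1 := Finset.card_filter_add_card_filter_not (s := X ×ˢ Xᶜ) (fun e => G.Adj e.1 e.2)
    rw [Finset.card_product] at h1
    have h2 : ((X ×ˢ Xᶜ).filter fun e => ¬ G.Adj e.1 e.2).card =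
        ∑ v, (Finset.univ.filter fun w => v ∈ X ∧ w ∉ X ∧ ¬ G.Adj v w).card := by
      rw [← Finset.card_sigma]
      refine Finset.card_bij' (fun e _ => ⟨e.1, e.2⟩) (fun e _ => (e.1, e.2)) ?_ ?_ ?_ ?_ <;>
        simp +contextual
    exact h1.symm.le.trans (by rw [h2, add_comm]; gcongr)

theorem isomorphic_K_sub_of_missing {n k : ℕ} (hkn : k + 2 ≤ n) {V : Type*} [Fintype V]
    {G : Digraph V} (hV : Fintype.card V = n) {M : V → Finset V} (hself : ∀ v, v ∉ M v)
    (hG : ∀ v w, G.Adj v w ↔ w ≠ v ∧ w ∉ M v) (hsum : ∑ v, (M v).card = n - 1 - k)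
    {v₀ : V} (hv₀ : (M v₀).card = n - 1 - k) : G.Isomorphic (K n k (n - k - 1)) := by
  classical
  have hempty : ∀ v, v ≠ v₀ → M v = ∅ := by
    intro v hv
    have h1 := Finset.add_sum_erase Finset.univ (fun v => (M v).card) (Finset.mem_univ v₀)
    have h2 : ∑ v ∈ Finset.univ.erase v₀, (M v).card = 0 := by omega
    exact Finset.card_eq_zero.1
      (Finset.sum_eq_zero_iff.1 h2 v (Finset.mem_erase.2 ⟨hv, Finset.mem_univ _⟩))
  have hne : ∀ v, v ∈ M v₀ → v ≠ v₀ := fun v hv h => hself v₀ (h ▸ hv)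
  refine isomorphic_K_of_label (by omega) hV
    (fun v => if v = v₀ then 1 else if v ∈ M v₀ then 2 else 0) ?_ ?_ ?_
  · have : (Finset.univ.filter fun v =>
        (if v = v₀ then (1 : Fin 3) else if v ∈ M v₀ then 2 else 0) = 1) = {v₀} := by
      ext v
      by_cases h1 : v = v₀ <;> by_cases h2 : v ∈ M v₀ <;> simp [h1, h2]
    rw [this, Finset.card_singleton]
    omega
  · have : (Finset.univ.filter fun v =>
        (if v = v₀ then (1 : Fin 3) else if v ∈ M v₀ then 2 else 0) = 2) = M v₀ := by
      ext v
      by_cases h1 : v = v₀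
      · subst h1; simp [hself]
      · by_cases h2 : v ∈ M v₀ <;> simp [h1, h2]
    rw [this, hv₀]
    omega
  · intro u v
    rw [hG]
    by_cases h1 : u = v₀
    · subst h1
      by_cases h2 : v = u
      · subst h2; simp [hself]
      · by_cases h3 : v ∈ M u <;> simp [h2, h3, Ne.symm h2]
    · by_cases h2 : u ∈ M v₀ <;> simp [hempty u h1, h1, h2, eq_comm]

theorem isomorphic_K_one_of_missing {n k : ℕ} (hkn : k + 2 ≤ n) {V : Type*} [Fintype V]
    {G : Digraph V} (hV : Fintype.card V = n) {M : V → Finset V} (hself : ∀ v, v ∉ M v)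
    (hG : ∀ v w, G.Adj v w ↔ w ≠ v ∧ w ∉ M v) (hsum : ∑ v, (M v).card = n - 1 - k)
    {p : V} (hp : ∀ v, M v ⊆ {p}) : G.Isomorphic (K n k 1) := by
  classical
  have hmem : ∀ v w, w ∈ M v ↔ w = p ∧ p ∈ M v := fun v w =>
    ⟨fun h => ⟨Finset.mem_singleton.1 (hp v h), Finset.mem_singleton.1 (hp v h) ▸ h⟩,
      fun h => h.1 ▸ h.2⟩
  refine isomorphic_K_of_label (by omega) hV
    (fun v => if p ∈ M v then 1 else if v = p then 2 else 0) ?_ ?_ ?_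
  -- Since `M v ⊆ {p}`, the size of `M v` is the indicator of label 1, so that part has ∑ |M v|
  -- vertices.
  · have h1 : ∀ v, (if (if p ∈ M v then (1 : Fin 3) else if v = p then 2 else 0) = 1
        then 1 else 0) = (M v).card := by
      intro v
      by_cases h : p ∈ M v
      · have : M v = {p} := Finset.Subset.antisymm (hp v) (by simpa using h)
        simp [this]
      · have : M v = ∅ := Finset.eq_empty_of_forall_notMem fun w hw => h ((hmem v w).1 hw).2
        rw [if_neg h, this, Finset.card_empty]
        by_cases h2 : v = p <;> simp [h2]
    rw [Finset.card_filter, Finset.sum_congr rfl fun v _ => h1 v, hsum]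
    omega
  · have : (Finset.univ.filter fun v =>
        (if p ∈ M v then (1 : Fin 3) else if v = p then 2 else 0) = 2) = {p} := by
      ext v
      by_cases h1 : v = p
      · subst h1; simp [hself]
      · by_cases h2 : p ∈ M v <;> simp [h1, h2]
    rw [this, Finset.card_singleton]
  · intro u v
    rw [hG, hmem]
    by_cases h1 : p ∈ M u <;> by_cases h2 : v = p
    · subst h2; simp [h1, hself]
    · by_cases h3 : p ∈ M v <;> simp [h1, h2, h3, eq_comm]
    · subst h2; by_cases h3 : u = v <;> simp [h1, h3, eq_comm]
    · by_cases h3 : u = p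
      · subst h3; simp [h1, h2, Ne.symm h2]
      · simp [h1, h2, h3, eq_comm]

/-- The value of the spectral radius attached to a root `y`. -/
noncomputable def extremalValue (n : ℕ) (α y : ℝ) : ℝ≥0∞ :=
  ENNReal.ofReal ((n : ℝ) - 2 + α + (1 - α) * y)

theorem MemL.alphaSpectralRadius_le {n k : ℕ} (hk : 1 ≤ k) (hkn : k + 2 ≤ n) {α y : ℝ}
    (hα : 0 ≤ α) (hα1 : α < 1) (hy : 0 < y)
    (hroot : 1 - y =
      ((n - 1 - k : ℕ) : ℝ) / ((1 - α) * (n - 1 + y) + α * (n - 1 - k : ℕ)))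
    {V : Type*} [Fintype V] [DecidableEq V] {G : Digraph V}
    (h : G.MemL n k) : G.alphaSpectralRadius α ≤ extremalValue n α y ∧
      (G.alphaSpectralRadius α = extremalValue n α y →
        G.Isomorphic (K n k (n - k - 1)) ∨ α = 0 ∧ G.Isomorphic (K n k 1)) := by
  classical
  have hV := h.card_eq
  have hk' : (1 : ℝ) ≤ k := by exact_mod_cast hk
  have hkn' : (k : ℝ) + 2 ≤ n := by exact_mod_cast hkn
  have hC : 0 < (1 - α) * ((n : ℝ) - 1 + y) := by apply mul_pos <;> linarith
  obtain ⟨X, M, hX, hXc, hM, hG, hcount⟩ := h.exists_missing hk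
  have hself : ∀ v, v ∉ M v := fun v hv => (hM v v hv).2 (hM v v hv).1
  have htrans : ∀ v, ∀ w ∈ M v, M w = ∅ := fun v w hw =>
    Finset.eq_empty_of_forall_notMem fun z hz => (hM v w hw).2 (hM w z hz).1
  have hXcard : X.card + Xᶜ.card = n := by rw [Finset.card_add_card_compl, hV]
  have ha := hX.card_pos
  have hb := hXc.card_pos
  have hge : n - 1 - k ≤ ∑ v, (M v).card := by
    -- This is (|X| - 1)(|Xᶜ| - 1) ≥ 0.
    have : X.card + Xᶜ.card ≤ X.card * Xᶜ.card + 1 := by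
      obtain ⟨a, ha'⟩ := Nat.exists_eq_add_of_lt ha
      obtain ⟨b, hb'⟩ := Nat.exists_eq_add_of_lt hb
      rw [ha', hb']; nlinarith [Nat.zero_le (a * b)]
    omega
  obtain ⟨hΓ, hΓeq⟩ := Finset.div_le_sum_div hα hC (fun v => (M v).card)
    (show 1 ≤ n - 1 - k by omega) hge
  rw [← hroot] at hΓ hΓeq
  have hVr : (Fintype.card V : ℝ) = n := by rw [hV]
  rw [← hVr] at hΓ hΓeq
  have hrow := mulVec_testVector_le hα hα1 hy hself htrans hG hΓ
  have hpos := testVector_pos hα hα1 hy hself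
  have hBnn := G.alphaMatrix_nonneg hα hα1
  rw [extremalValue, ← hVr]
  refine ⟨Matrix.spectralRadius_le_of_mulVec_le hBnn hpos fun v => (hrow v).1, fun heq => ?_⟩
  obtain ⟨x₀, hx₀⟩ := hX
  have : Nonempty V := ⟨x₀⟩
  have hr : 0 ≤ (Fintype.card V : ℝ) - 2 + α + (1 - α) * y := by
    rw [hV]
    have : 0 < (1 - α) * y := mul_pos (by linarith) hy
    linarith
  have htight := Matrix.mulVec_eq_of_spectralRadius_eq hBnn hpos hr (fun v => (hrow v).1)
    (h.stronglyConnected.reflTransGen_alphaMatrix hα hα1) heq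
  have hG' : ∀ v w, G.Adj v w ↔ w ≠ v ∧ w ∉ M v := fun v w =>
    ⟨hG v w, fun hw => ((hrow v).2 (congrFun htight v)).2 w hw.1 hw.2⟩
  obtain ⟨hS, hcase⟩ := hΓeq ((hrow x₀).2 (congrFun htight x₀)).1
  rcases hcase with hα0 | ⟨v₀, hv₀⟩
  -- Now |X||Xᶜ| ≤ S + k = n-1, whereas two sides of size at least 2 would give |X||Xᶜ| ≥ n.
  · have hab : X.card = 1 ∨ Xᶜ.card = 1 := by
      by_contra! hab
      have h1 : 2 ≤ X.card := by omega
      have h2 : 2 ≤ Xᶜ.card := by omega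
      have : X.card + Xᶜ.card ≤ X.card * Xᶜ.card := by nlinarith
      omega
    rcases hab with h1 | h1
    · obtain ⟨v₀, rfl⟩ := Finset.card_eq_one.1 h1
      refine .inl (isomorphic_K_sub_of_missing hkn hV hself hG' hS (v₀ := v₀) ?_)
      rw [← hS]
      refine (Finset.sum_eq_single (f := fun v => (M v).card) v₀ (fun v _ hv => ?_) fun h => absurd (Finset.mem_univ _) h).symm
      exact Finset.card_eq_zero.2 (Finset.eq_empty_of_forall_notMem fun w hw =>
        hv (Finset.mem_singleton.1 (hM v w hw).1))
    · obtain ⟨p, hp⟩ := Finset.card_eq_one.1 h1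
      refine .inr ⟨hα0, isomorphic_K_one_of_missing hkn hV hself hG' hS (p := p) fun v w hw => ?_⟩
      rw [← hp]
      exact Finset.mem_compl.2 (hM v w hw).2
  · exact .inl (isomorphic_K_sub_of_missing hkn hV hself hG' hS hv₀)

/-- Only the n-k-m middle vertices miss arcs, `m` each, so `hm` says that the test vector is an
exact eigenvector. -/
theorem alphaSpectralRadius_K {n k : ℕ} (hk : 1 ≤ k) (hkn : k + 2 ≤ n) {α y : ℝ}
    (hα : 0 ≤ α) (hα1 : α < 1) (hy : 0 < y)
    {m : ℕ} (hkm : k + m ≤ n)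
    (hm : (n - k - m : ℕ) * ((m : ℝ) / ((1 - α) * (n - 1 + y) + α * m)) = 1 - y) :
    (K n k m).alphaSpectralRadius α = extremalValue n α y := by
  classical
  have hk' : (1 : ℝ) ≤ k := by exact_mod_cast hk
  have hkn' : (k : ℝ) + 2 ≤ n := by exact_mod_cast hkn
  have hcard : Fintype.card (Fin k ⊕ (Fin (n - k - m) ⊕ Fin m)) = n := by simp; omega
  let M : Fin k ⊕ (Fin (n - k - m) ⊕ Fin m) → Finset (Fin k ⊕ (Fin (n - k - m) ⊕ Fin m)) :=
    fun v => Finset.univ.filter fun w => partLabel v = 1 ∧ partLabel w = 2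
  have hmem : ∀ v w, w ∈ M v ↔ partLabel v = 1 ∧ partLabel w = 2 := fun v w => by simp [M]
  have hself : ∀ v, v ∉ M v := fun v hv => by
    rw [hmem] at hv
    exact absurd (hv.1.symm.trans hv.2) (by decide)
  have htrans : ∀ v, ∀ w ∈ M v, M w = ∅ := fun v w hw =>
    Finset.eq_empty_of_forall_notMem fun z hz => by
      rw [hmem] at hw hz
      exact absurd (hz.1.symm.trans hw.2) (by decide)
  have hM : ∀ v, (M v).card = if partLabel v = 1 then m else 0 := by
    intro v
    by_cases hv : partLabel v = 1
    · simpa [M, hv] using card_partLabel n k m 2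
    · simp [M, hv]
  have hsum : 1 - y = ∑ w, ((M w).card : ℝ) /
      ((1 - α) * ((Fintype.card (Fin k ⊕ (Fin (n - k - m) ⊕ Fin m)) : ℝ) - 1 + y) +
        α * (M w).card) := by
    rw [hcard, ← hm]
    have h1 : ∀ w, ((M w).card : ℝ) / ((1 - α) * ((n : ℝ) - 1 + y) + α * (M w).card) =
        if partLabel w = 1 then (m : ℝ) / ((1 - α) * ((n : ℝ) - 1 + y) + α * m) else 0 := by
      intro w
      rw [hM]
      split_ifs <;> simp
    rw [Finset.sum_congr rfl fun w _ => h1 w, ← Finset.sum_filter, Finset.sum_const,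
      card_partLabel, nsmul_eq_mul]
    rfl
  have : Nonempty (Fin k ⊕ (Fin (n - k - m) ⊕ Fin m)) := ⟨.inl ⟨0, hk⟩⟩
  have hr : 0 ≤ (n : ℝ) - 2 + α + (1 - α) * y := by
    have : 0 < (1 - α) * y := mul_pos (by linarith) hy
    linarith
  have heq := mulVec_testVector_eq (G := K n k m) hα hα1 hy hself htrans (fun v w => by
    rw [K_adj, hmem, ne_comm]) hsum
  have := Matrix.spectralRadius_eq_of_mulVec_eq ((K n k m).alphaMatrix_nonneg hα hα1)
    (testVector_pos hα hα1 hy hself) (by rw [hcard]; exact hr) heq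
  rw [hcard] at this
  exact this

theorem alphaSpectralRadius_K_sub {n k : ℕ} (hk : 1 ≤ k) (hkn : k + 2 ≤ n) {α y : ℝ}
    (hα : 0 ≤ α) (hα1 : α < 1) (hy : 0 < y)
    (hroot : 1 - y =
      ((n - 1 - k : ℕ) : ℝ) / ((1 - α) * (n - 1 + y) + α * (n - 1 - k : ℕ))) :
    (K n k (n - k - 1)).alphaSpectralRadius α = extremalValue n α y := by
  refine alphaSpectralRadius_K hk hkn hα hα1 hy (by omega) ?_
  rw [show n - k - (n - k - 1) = 1 by omega, show n - k - 1 = n - 1 - k by omega, hroot]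
  simp

end Digraph

theorem mainTheorem2 (n k : ℕ) (hk : 1 ≤ k) (hkn : k + 2 ≤ n) :
    -- the two candidate digraphs belong to the class
    Digraph.MemL n k (Digraph.K n k (n - k - 1)) ∧
    Digraph.MemL n k (Digraph.K n k 1) ∧
    -- the case `α = 0`
    (Digraph.alphaSpectralRadius 0 (Digraph.K n k 1) =
        Digraph.alphaSpectralRadius 0 (Digraph.K n k (n - k - 1)) ∧
      ∀ (V : Type*) [Fintype V] [DecidableEq V] (G : Digraph V), G.MemL n k →
        G.alphaSpectralRadius 0 ≤ Digraph.alphaSpectralRadius 0 (Digraph.K n k (n - k - 1)) ∧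
        (G.alphaSpectralRadius 0 = Digraph.alphaSpectralRadius 0 (Digraph.K n k (n - k - 1)) ↔
          G.Isomorphic (Digraph.K n k (n - k - 1)) ∨ G.Isomorphic (Digraph.K n k 1))) ∧
    -- the case `0 < α < 1`
    (∀ α : ℝ, 0 < α → α < 1 →
      ∀ (V : Type*) [Fintype V] [DecidableEq V] (G : Digraph V), G.MemL n k →
        G.alphaSpectralRadius α ≤ Digraph.alphaSpectralRadius α (Digraph.K n k (n - k - 1)) ∧
        (G.alphaSpectralRadius α = Digraph.alphaSpectralRadius α (Digraph.K n k (n - k - 1)) ↔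
          G.Isomorphic (Digraph.K n k (n - k - 1)))) := by
  refine ⟨Digraph.K_memL_sub hk hkn, Digraph.K_memL_one hk hkn, ?_, ?_⟩
  · obtain ⟨y, hy, hroot⟩ := Digraph.exists_quadratic_root hk hkn le_rfl zero_lt_one
    have hsub := Digraph.alphaSpectralRadius_K_sub hk hkn le_rfl zero_lt_one hy hroot
    have hone : (Digraph.K n k 1).alphaSpectralRadius 0 = Digraph.extremalValue n 0 y := by
      -- At α = 0 the terms are linear in s, so S vertices missing one arc each give the same sum as
      -- one vertex missing S.
      refine Digraph.alphaSpectralRadius_K hk hkn le_rfl zero_lt_one hy (by omega) ?_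
      rw [hroot, show n - k - 1 = n - 1 - k by omega]
      simp [div_eq_mul_inv]
    refine ⟨hone.trans hsub.symm, fun V _ _ G hG => ?_⟩
    rw [hsub]
    obtain ⟨hle, heq⟩ := hG.alphaSpectralRadius_le hk hkn le_rfl zero_lt_one hy hroot
    refine ⟨hle, fun h => (heq h).imp_right And.right, fun h => ?_⟩
    rcases h with h | h
    · rw [Digraph.alphaSpectralRadius_eq_of_isomorphic h, hsub]
    · rw [Digraph.alphaSpectralRadius_eq_of_isomorphic h, hone]
  · intro α hα hα1 V _ _ G hG
    obtain ⟨y, hy, hroot⟩ := Digraph.exists_quadratic_root hk hkn hα.le hα1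
    have hsub := Digraph.alphaSpectralRadius_K_sub hk hkn hα.le hα1 hy hroot
    rw [hsub]
    obtain ⟨hle, heq⟩ := hG.alphaSpectralRadius_le hk hkn hα.le hα1 hy hroot
    refine ⟨hle, fun h => (heq h).resolve_right fun h' => hα.ne' h'.1, fun h => ?_⟩
    rw [Digraph.alphaSpectralRadius_eq_of_isomorphic h, hsub]
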